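/- **Proposition 5.1.** Let $X$ be a (finite dimensional, complex) Banach space with a $1$-unconditional basis $(x_k)_{k=1}^n$, i.e. a basis such that $\big\|\sum_k \theta_k a_k x_k\big\| \le \big\|\sum_k a_k x_k\big\|$ for all scalars $a_k,\theta_k\in\mathbb C$ with $|\theta_k|\le 1$. Then for every $m\ge 2$ 1. $\displaystyle \mathrm{gl}\big(\otimes^{m,s}_{\varepsilon}X\big)\le 2\,\lambda\big(\otimes^{m-1,s}_{\varepsilon}X\big)$, 2. $\displaystyle \mathrm{gl}\big(\otimes^{m,s}_{\varepsilon_s}X\big)\le 2\Big(\frac{m^m}{m!}\Big)^2\lambda\big(\otimes^{m-1,s}_{\varepsilon_s}X\big)$. Here $\otimes^{m,s}X\subset\otimes^mX$ is the image of the symmetrization operator $y_1\otimes\cdots\otimes y_m\mapsto\frac1{m!}\sum_{\sigma}y_{\sigma(1)}\otimes\cdots\otimes y_{\sigma(m)}$; $\otimes^{m,s}_{\varepsilon}X$ is this space with the norm induced by the injective norm $\varepsilon(z)=\sup\{|\langle\varphi_1\otimes\cdots\otimes\varphi_m,z\rangle| : \varphi_i\in X^*,\ \|\varphi_i\|\le1\}$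 of $\otimes^m X$; and $\otimes^{m,s}_{\varepsilon_s}X$ is the same space with the symmetric injective norm $\varepsilon_s(z)=\sup\{|\langle\varphi\otimes\cdots\otimes\varphi,z\rangle| : \varphi\in X^*,\ \|\varphi\|\le1\}$. For a complex Banach space $Y$, the Gordon–Lewis constant $\mathrm{gl}(Y)$ is the least $c\in[0,\infty]$ with $\gamma_1(T)\le c\,\pi_1(T)$ for all $1$-summing operators $T:Y\to\ell_2$, where $\gamma_1(T)=\inf\|R\|\,\|S\|$ over all measures $\mu$ and all factorizations $T=SR$ with bounded operators $R:Y\to L_1(\mu)$, $S:L_1(\mu)\to\ell_2$, and $\pi_1(T)=\sup\big\{\sum_{i}\|Ty_i\|\big\}$ over all finite families $(y_i)$ in $Y$ with $\big\|\sum_i\lambda_iy_i\big\|\le1$ whenever $|\lambda_i|\le1$ for all $i$. The projection constant is $\lambda(Y)=\sup\lambda(I(Y),Z)$ over all isometric linear embeddings $I$ of $Y$ into complex Banach spaces $Z$, where $\lambda(I(Y),Z)$ is the infimum of $\|P\|$ over all bounded linear projections $P$ of $Z$ onto $I(Y)$. -/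

import Mathlib

open scoped ENNReal NNReal TensorProduct

noncomputable section

namespace GordonLewis

universe u

/-! ### Local Banach space theory -/

/-- The `1`-summing norm of a bounded operator `T : X → Y`: the supremum of `∑ ‖T xᵢ‖` over all
finite families `(xᵢ)` with `‖∑ lᵢ xᵢ‖ ≤ 1` for all scalars `|lᵢ| ≤ 1`
(it is `∞` if `T` is not `1`-summing). -/
def oneSummingNorm {X Y : Type*} [NormedAddCommGroup X] [NormedSpace ℂ X]
    [NormedAddCommGroup Y] [NormedSpace ℂ Y] (T : X →L[ℂ] Y) : ℝ≥0∞ :=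
  ⨆ (n : ℕ) (x : Fin n → X)
    (_ : ∀ l : Fin n → ℂ, (∀ i, ‖l i‖ ≤ 1) → ‖∑ i, l i • x i‖ ≤ 1),
    ∑ i, ‖T (x i)‖ₑ

/-- `γ₁(T) = inf ‖R‖ ‖S‖`, the infimum over all factorizations `T = S ∘ R` through some
`L₁(μ)` by bounded operators `R`, `S` (it is `∞` if there is none). -/
def gammaOne {X : Type u} [NormedAddCommGroup X] [NormedSpace ℂ X]
    {Y : Type*} [NormedAddCommGroup Y] [NormedSpace ℂ Y] (T : X →L[ℂ] Y) : ℝ≥0∞ :=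
  ⨅ (Ω : Type u) (_ : MeasurableSpace Ω) (μ : MeasureTheory.Measure Ω)
    (R : X →L[ℂ] MeasureTheory.Lp ℂ 1 μ) (S : MeasureTheory.Lp ℂ 1 μ →L[ℂ] Y)
    (_ : S.comp R = T), ‖R‖ₑ * ‖S‖ₑ

/-- The Gordon–Lewis constant `gl(X)`: the best `c ≥ 0` such that `γ₁(T) ≤ c π₁(T)` for every
`1`-summing operator `T : X → ℓ₂` (it is `∞` if there is no such `c`). -/
def gl (X : Type u) [NormedAddCommGroup X] [NormedSpace ℂ X] : ℝ≥0∞ :=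
  ⨅ (c : ℝ≥0)
    (_ : ∀ T : X →L[ℂ] lp (fun _ : ℕ => ℂ) 2,
      oneSummingNorm T < ∞ → gammaOne T ≤ c * oneSummingNorm T), (c : ℝ≥0∞)

/-- The relative projection constant `λ(Y, Z)`: the infimum of `‖P‖` over all bounded
projections `P` of `Z` onto the subspace `Y`. -/
def relProjConst {Z : Type*} [NormedAddCommGroup Z] [NormedSpace ℂ Z] (Y : Submodule ℂ Z) :
    ℝ≥0∞ :=
  ⨅ (P : Z →L[ℂ] Z) (_ : LinearMap.IsProj Y P), ‖P‖ₑ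

/-- The projection constant `λ(X)`: the supremum of `λ(I(X), Z)` over all isometric embeddings
`I` of `X` into Banach spaces `Z`. -/
def projConst (X : Type u) [NormedAddCommGroup X] [NormedSpace ℂ X] : ℝ≥0∞ :=
  ⨆ (Z : Type u) (_ : NormedAddCommGroup Z) (_ : NormedSpace ℂ Z) (_ : CompleteSpace Z)
    (I : X →ₗᵢ[ℂ] Z), relProjConst (LinearMap.range I.toLinearMap)

/-- The basis `x` of `X` is `1`-unconditional: multiplying coefficients by scalars of modulus at
most `1` does not increase the norm. -/
def IsOneUnconditional {X : Type*} [NormedAddCommGroup X] [NormedSpace ℂ X] {n : ℕ}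
    (x : Module.Basis (Fin n) ℂ X) : Prop :=
  ∀ a θ : Fin n → ℂ, (∀ k, ‖θ k‖ ≤ 1) →
    ‖∑ k, (θ k * a k) • x k‖ ≤ ‖∑ k, a k • x k‖

/-! ### Symmetric tensor products -/

section Tensor

variable (m : ℕ) (X : Type u) [NormedAddCommGroup X] [NormedSpace ℂ X]

/-- The symmetrization operator `S_m` on the `m`-fold tensor product `⊗ᵐ X`. -/
def symmetrizer : (⨂[ℂ] _ : Fin m, X) →ₗ[ℂ] (⨂[ℂ] _ : Fin m, X) :=
  ((m.factorial : ℂ)⁻¹) • ∑ σ : Equiv.Perm (Fin m),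
    (PiTensorProduct.reindex ℂ (fun _ : Fin m => X) σ).toLinearMap

/-- `S_m (y₁ ⊗ ⋯ ⊗ y_m) = (1 / m!) ∑_σ y_{σ(1)} ⊗ ⋯ ⊗ y_{σ(m)}`. -/
theorem symmetrizer_tprod (y : Fin m → X) :
    symmetrizer m X (PiTensorProduct.tprod ℂ y) =
      ((m.factorial : ℂ)⁻¹) • ∑ σ : Equiv.Perm (Fin m),
        PiTensorProduct.tprod ℂ (fun i => y (σ i)) := by
  simp only [symmetrizer, LinearMap.smul_apply, LinearMap.sum_apply, LinearEquiv.coe_coe,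
    PiTensorProduct.reindex_tprod]
  congr 1
  exact Fintype.sum_equiv (Equiv.inv _) _ _ (fun σ => rfl)

/-- The `m`-th symmetric tensor product `⊗^{m,s} X`, the image of the symmetrization operator. -/
def symTensors : Submodule ℂ (⨂[ℂ] _ : Fin m, X) := LinearMap.range (symmetrizer m X)

variable {m X}

/-- The linear functional `φ₁ ⊗ ⋯ ⊗ φ_m` on `⊗ᵐ X`. -/
def tensorEval (φ : Fin m → StrongDual ℂ X) : (⨂[ℂ] _ : Fin m, X) →ₗ[ℂ] ℂ :=
  PiTensorProduct.lift ((MultilinearMap.mkPiAlgebra ℂ (Fin m) ℂ).compLinearMap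
    (fun i => (φ i : X →ₗ[ℂ] ℂ)))

@[simp]
theorem tensorEval_tprod (φ : Fin m → StrongDual ℂ X) (y : Fin m → X) :
    tensorEval φ (PiTensorProduct.tprod ℂ y) = ∏ i, φ i (y i) := by
  simp [tensorEval]

/-- The injective norm `ε` on `⊗ᵐ X`:
`ε(z) = sup {|⟨φ₁ ⊗ ⋯ ⊗ φ_m, z⟩| : φ₁, …, φ_m in the closed unit ball of X*}`. -/
def injNorm (z : ⨂[ℂ] _ : Fin m, X) : ℝ :=
  ⨆ φ : {φ : Fin m → StrongDual ℂ X // ∀ i, ‖φ i‖ ≤ 1}, ‖tensorEval φ.1 z‖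

/-- The symmetric injective norm `ε_s`:
`ε_s(z) = sup {|⟨φ ⊗ ⋯ ⊗ φ, z⟩| : φ in the closed unit ball of X*}`. -/
def symInjNorm (z : ⨂[ℂ] _ : Fin m, X) : ℝ :=
  ⨆ φ : {φ : StrongDual ℂ X // ‖φ‖ ≤ 1}, ‖tensorEval (fun _ : Fin m => φ.1) z‖

/-! #### These are norms -/

theorem exists_bound_tensorEval (z : ⨂[ℂ] _ : Fin m, X) :
    ∃ C : ℝ, ∀ φ : Fin m → StrongDual ℂ X, (∀ i, ‖φ i‖ ≤ 1) → ‖tensorEval φ z‖ ≤ C := by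
  induction z using PiTensorProduct.induction_on with
  | smul_tprod r y =>
    refine ⟨‖r‖ * ∏ i, ‖y i‖, fun φ hφ => ?_⟩
    rw [map_smul, norm_smul, tensorEval_tprod, norm_prod]
    gcongr with i
    exact (φ i).le_of_opNorm_le (hφ i) (y i) |>.trans (by simp)
  | add x y hx hy =>
    obtain ⟨C, hC⟩ := hx
    obtain ⟨D, hD⟩ := hy
    refine ⟨C + D, fun φ hφ => ?_⟩
    rw [map_add]
    exact (norm_add_le _ _).trans (add_le_add (hC φ hφ) (hD φ hφ))

theorem norm_tensorEval_le_injNorm (z : ⨂[ℂ] _ : Fin m, X) (φ : Fin m → StrongDual ℂ X)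
    (hφ : ∀ i, ‖φ i‖ ≤ 1) : ‖tensorEval φ z‖ ≤ injNorm z := by
  obtain ⟨C, hC⟩ := exists_bound_tensorEval z
  exact le_ciSup (f := fun φ : {φ : Fin m → StrongDual ℂ X // ∀ i, ‖φ i‖ ≤ 1} =>
    ‖tensorEval φ.1 z‖) ⟨C, by rintro _ ⟨φ, rfl⟩; exact hC φ.1 φ.2⟩ ⟨φ, hφ⟩

theorem norm_tensorEval_le_symInjNorm (z : ⨂[ℂ] _ : Fin m, X) (φ : StrongDual ℂ X)
    (hφ : ‖φ‖ ≤ 1) : ‖tensorEval (fun _ : Fin m => φ) z‖ ≤ symInjNorm z := by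
  obtain ⟨C, hC⟩ := exists_bound_tensorEval z
  exact le_ciSup (f := fun φ : {φ : StrongDual ℂ X // ‖φ‖ ≤ 1} =>
    ‖tensorEval (fun _ : Fin m => φ.1) z‖)
    ⟨C, by rintro _ ⟨φ, rfl⟩; exact hC _ (fun _ => φ.2)⟩ ⟨φ, hφ⟩

instance : Nonempty {φ : Fin m → StrongDual ℂ X // ∀ i, ‖φ i‖ ≤ 1} := ⟨⟨0, by simp⟩⟩

instance : Nonempty {φ : StrongDual ℂ X // ‖φ‖ ≤ 1} := ⟨⟨0, by simp⟩⟩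

theorem injNorm_nonneg (z : ⨂[ℂ] _ : Fin m, X) : 0 ≤ injNorm z :=
  Real.iSup_nonneg fun _ => norm_nonneg _

theorem symInjNorm_nonneg (z : ⨂[ℂ] _ : Fin m, X) : 0 ≤ symInjNorm z :=
  Real.iSup_nonneg fun _ => norm_nonneg _

theorem injNorm_add_le (z w : ⨂[ℂ] _ : Fin m, X) :
    injNorm (z + w) ≤ injNorm z + injNorm w := by
  refine ciSup_le fun φ => ?_
  rw [map_add]
  exact (norm_add_le _ _).trans (add_le_add (norm_tensorEval_le_injNorm z _ φ.2)
    (norm_tensorEval_le_injNorm w _ φ.2))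

theorem symInjNorm_add_le (z w : ⨂[ℂ] _ : Fin m, X) :
    symInjNorm (z + w) ≤ symInjNorm z + symInjNorm w := by
  refine ciSup_le fun φ => ?_
  rw [map_add]
  exact (norm_add_le _ _).trans (add_le_add (norm_tensorEval_le_symInjNorm z _ φ.2)
    (norm_tensorEval_le_symInjNorm w _ φ.2))

theorem injNorm_smul (c : ℂ) (z : ⨂[ℂ] _ : Fin m, X) : injNorm (c • z) = ‖c‖ * injNorm z := by
  simp only [injNorm, map_smul, norm_smul]
  exact (Real.mul_iSup_of_nonneg (norm_nonneg c) _).symm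

theorem symInjNorm_smul (c : ℂ) (z : ⨂[ℂ] _ : Fin m, X) :
    symInjNorm (c • z) = ‖c‖ * symInjNorm z := by
  simp only [symInjNorm, map_smul, norm_smul]
  exact (Real.mul_iSup_of_nonneg (norm_nonneg c) _).symm

theorem tensorEval_smul (c : ℂ) (φ : Fin m → StrongDual ℂ X) (z : ⨂[ℂ] _ : Fin m, X) :
    tensorEval (fun i => c • φ i) z = c ^ m * tensorEval φ z := by
  induction z using PiTensorProduct.induction_on with
  | smul_tprod r y => simp [Finset.prod_mul_distrib]; ring
  | add x y hx hy => simp only [map_add, hx, hy]; ring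

/-- The functionals `φ₁ ⊗ ⋯ ⊗ φ_m` separate the points of `⊗ᵐ X`. -/
theorem eq_zero_of_tensorEval (z : ⨂[ℂ] _ : Fin m, X)
    (h : ∀ φ : Fin m → StrongDual ℂ X, tensorEval φ z = 0) : z = 0 := by
  classical
  let b := Module.Basis.ofVectorSpace ℂ X
  let B := Basis.piTensorProduct (fun _ : Fin m => b)
  let F : Finset (Module.Basis.ofVectorSpaceIndex ℂ X) :=
    (B.repr z).support.biUnion fun p => Finset.univ.image p
  let V : Submodule ℂ X := Submodule.span ℂ (b '' F)
  have : FiniteDimensional ℂ V :=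
    FiniteDimensional.span_of_finite ℂ (F.finite_toSet.image b)
  have hψ : ∀ k, ∃ ψ : StrongDual ℂ X, ∀ v ∈ V, ψ v = b.coord k v := fun k => by
    obtain ⟨g, hg, -⟩ := exists_extension_norm_eq V
      (LinearMap.toContinuousLinearMap ((b.coord k).comp V.subtype))
    exact ⟨g, fun v hv => by simpa using hg ⟨v, hv⟩⟩
  choose ψ hψ using hψ
  refine B.ext_elem fun q => ?_
  have hq := h fun i => ψ (q i)
  rw [← B.linearCombination_repr z, Finsupp.linearCombination_apply, Finsupp.sum, map_sum] at hq
  have key : ∀ p ∈ (B.repr z).support,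
      tensorEval (fun i => ψ (q i)) (B.repr z p • B p) = if p = q then B.repr z p else 0 := by
    intro p hp
    have hv : ∀ i, ψ (q i) (b (p i)) = if p i = q i then 1 else 0 := fun i => by
      rw [hψ _ _ (Submodule.subset_span ⟨p i, ?_, rfl⟩)]
      · simp [Finsupp.single_apply]
      · exact Finset.mem_coe.2 (Finset.mem_biUnion.2 ⟨p, hp, by simp⟩)
    rw [map_smul, show B p = PiTensorProduct.tprod ℂ (fun i => b (p i)) from
      Basis.piTensorProduct_apply _ p, tensorEval_tprod]
    simp only [hv, Fintype.prod_ite_zero, ← funext_iff]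
    simp
  rw [Finset.sum_congr rfl key, Finset.sum_ite_eq'] at hq
  simpa using hq

theorem tensorEval_reindex (σ : Equiv.Perm (Fin m)) (φ : Fin m → StrongDual ℂ X)
    (z : ⨂[ℂ] _ : Fin m, X) :
    tensorEval φ (PiTensorProduct.reindex ℂ (fun _ : Fin m => X) σ z) =
      tensorEval (fun i => φ (σ i)) z := by
  induction z using PiTensorProduct.induction_on with
  | smul_tprod r y =>
    rw [map_smul, map_smul, map_smul, PiTensorProduct.reindex_tprod, tensorEval_tprod,
      tensorEval_tprod]
    congr 1
    exact Fintype.prod_equiv σ.symm _ _ (fun i => by simp)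
  | add x y hx hy => simp only [map_add, hx, hy]

theorem tensorEval_sum (φ : Fin m → StrongDual ℂ X) (c : Fin m → ℂ) (z : ⨂[ℂ] _ : Fin m, X) :
    tensorEval (fun _ : Fin m => ∑ k, c k • φ k) z =
      ∑ p : Fin m → Fin m, (∏ i, c (p i)) * tensorEval (fun i => φ (p i)) z := by
  induction z using PiTensorProduct.induction_on with
  | smul_tprod r y =>
    simp only [map_smul, tensorEval_tprod, FunLike.coe_sum, Finset.sum_apply,
      FunLike.coe_smul, Pi.smul_apply, smul_eq_mul]
    rw [Finset.prod_univ_sum, Fintype.piFinset_univ, Finset.mul_sum]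
    refine Finset.sum_congr rfl fun p _ => ?_
    rw [Finset.prod_mul_distrib]
    ring
  | add x y hx hy => simp only [map_add, hx, hy, mul_add, Finset.sum_add_distrib]

theorem sum_sign_prod (p : Fin m → Fin m) :
    ∑ e : Fin m → Fin 2, (∏ k, (-1 : ℂ) ^ (e k : ℕ)) * ∏ i, (-1 : ℂ) ^ (e (p i) : ℕ) =
      if Function.Bijective p then 2 ^ m else 0 := by
  classical
  have h1 : ∀ e : Fin m → Fin 2,
      (∏ k, (-1 : ℂ) ^ (e k : ℕ)) * ∏ i, (-1 : ℂ) ^ (e (p i) : ℕ) =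
        ∏ k, ((-1 : ℂ) ^ (e k : ℕ)) ^ (1 + (Finset.univ.filter fun i => p i = k).card) := by
    intro e
    simp only [pow_add, Finset.prod_mul_distrib, pow_one]
    congr 1
    rw [← Finset.prod_fiberwise Finset.univ p]
    refine Finset.prod_congr rfl fun k _ => ?_
    rw [Finset.prod_congr rfl (g := fun _ => (-1 : ℂ) ^ (e k : ℕ))
      (fun i hi => by rw [(Finset.mem_filter.1 hi).2]), Finset.prod_const]
  simp only [h1]
  have h2 := Finset.prod_univ_sum (fun _ : Fin m => (Finset.univ : Finset (Fin 2)))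
    (fun k a => ((-1 : ℂ) ^ (a : ℕ)) ^ (1 + (Finset.univ.filter fun i => p i = k).card))
  rw [Fintype.piFinset_univ] at h2
  rw [← h2]
  simp only [Fin.sum_univ_two]
  split_ifs with hp
  · have : ∀ k, (Finset.univ.filter fun i => p i = k).card = 1 := fun k => by
      obtain ⟨i, hi, hu⟩ := hp.existsUnique k
      rw [Finset.card_eq_one]
      exact ⟨i, by ext j; simpa using ⟨hu j, fun h => h ▸ hi⟩⟩
    simp [this]
    norm_num
  · have : ∃ k, ∀ i, p i ≠ k := by
      by_contra! hc
      exact hp (Finite.surjective_iff_bijective.1 hc)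
    obtain ⟨k, hk⟩ := this
    refine Finset.prod_eq_zero (Finset.mem_univ k) ?_
    simp [hk]

/-- Polarization. -/
theorem tensorEval_eq_zero_of_diag (z : ⨂[ℂ] _ : Fin m, X) (hz : z ∈ symTensors m X)
    (h : ∀ φ : StrongDual ℂ X, tensorEval (fun _ : Fin m => φ) z = 0)
    (φ : Fin m → StrongDual ℂ X) : tensorEval φ z = 0 := by
  classical
  have hinv : ∀ σ : Equiv.Perm (Fin m), tensorEval (fun i => φ (σ i)) z = tensorEval φ z := by
    obtain ⟨w, rfl⟩ := hz
    intro σ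
    simp only [symmetrizer, LinearMap.smul_apply, LinearMap.sum_apply, LinearEquiv.coe_coe,
      map_smul, map_sum, tensorEval_reindex]
    congr 1
    exact Fintype.sum_equiv (Equiv.mulLeft σ) _ _ (fun τ => rfl)
  have h0 : ∑ e : Fin m → Fin 2, (∏ k, (-1 : ℂ) ^ (e k : ℕ)) *
      tensorEval (fun _ : Fin m => ∑ k, ((-1 : ℂ) ^ (e k : ℕ)) • φ k) z = 0 :=
    Finset.sum_eq_zero fun e _ => by rw [h, mul_zero]
  simp only [tensorEval_sum, Finset.mul_sum, ← mul_assoc] at h0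
  rw [Finset.sum_comm] at h0
  simp only [← Finset.sum_mul, sum_sign_prod] at h0
  have h1 : ∀ p : Fin m → Fin m,
      (if Function.Bijective p then (2 : ℂ) ^ m else 0) * tensorEval (fun i => φ (p i)) z =
        (if Function.Bijective p then (2 : ℂ) ^ m else 0) * tensorEval φ z := fun p => by
    split_ifs with hp
    · rw [← hinv (Equiv.ofBijective p hp)]
      rfl
    · simp
  simp only [h1, ← Finset.sum_mul, ← Finset.sum_filter, Finset.sum_const, nsmul_eq_mul] at h0
  have hne : (Finset.univ.filter fun p : Fin m → Fin m => Function.Bijective p).card ≠ 0 :=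
    Finset.card_ne_zero_of_mem (a := id)
      (Finset.mem_filter.2 ⟨Finset.mem_univ _, Function.bijective_id⟩)
  rcases mul_eq_zero.mp h0 with h0 | h0
  · exact absurd h0 (mul_ne_zero (by exact_mod_cast hne) (by simp))
  · exact h0

theorem eq_zero_of_injNorm_eq_zero (z : ⨂[ℂ] _ : Fin m, X) (hz : injNorm z = 0) : z = 0 := by
  refine eq_zero_of_tensorEval z fun φ => ?_
  let C : ℝ := 1 + ∑ i, ‖φ i‖
  have hC : 0 < C := by positivity
  have hle : ∀ i, ‖((C⁻¹ : ℝ) : ℂ) • φ i‖ ≤ 1 := fun i => by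
    rw [norm_smul, Complex.norm_real, Real.norm_of_nonneg (by positivity), inv_mul_le_one₀ hC]
    have := Finset.single_le_sum (f := fun i => ‖φ i‖) (fun i _ => norm_nonneg _)
      (Finset.mem_univ i)
    simp only [C]
    linarith
  have h := norm_tensorEval_le_injNorm z _ hle
  rw [hz, norm_le_zero_iff, tensorEval_smul] at h
  exact (mul_eq_zero.mp h).resolve_left (pow_ne_zero _ (by exact_mod_cast (inv_pos.2 hC).ne'))

theorem eq_zero_of_symInjNorm_eq_zero (z : ⨂[ℂ] _ : Fin m, X) (hs : z ∈ symTensors m X)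
    (hz : symInjNorm z = 0) : z = 0 := by
  refine eq_zero_of_tensorEval z (tensorEval_eq_zero_of_diag z hs fun φ => ?_)
  let C : ℝ := 1 + ‖φ‖
  have hC : 0 < C := by positivity
  have hle : ‖((C⁻¹ : ℝ) : ℂ) • φ‖ ≤ 1 := by
    rw [norm_smul, Complex.norm_real, Real.norm_of_nonneg (by positivity), inv_mul_le_one₀ hC]
    simp [C]
  have h := norm_tensorEval_le_symInjNorm z _ hle
  rw [hz, norm_le_zero_iff, tensorEval_smul] at h
  exact (mul_eq_zero.mp h).resolve_left (pow_ne_zero _ (by exact_mod_cast (inv_pos.2 hC).ne'))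

end Tensor

section Spaces

variable (m : ℕ) (X : Type u) [NormedAddCommGroup X] [NormedSpace ℂ X]

/-- `⊗^{m,s}_ε X`: the symmetric tensor product with the norm induced by the injective norm `ε`
of the full tensor product `⊗ᵐ X`. -/
def SymTensorInj : Type u := symTensors m X

/-- `⊗^{m,s}_{ε_s} X`: the symmetric tensor product with the symmetric injective norm `ε_s`. -/
def SymTensorSymInj : Type u := symTensors m X

instance : AddCommGroup (SymTensorInj m X) := inferInstanceAs (AddCommGroup (symTensors m X))
instance : Module ℂ (SymTensorInj m X) := inferInstanceAs (Module ℂ (symTensors m X))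
instance : AddCommGroup (SymTensorSymInj m X) := inferInstanceAs (AddCommGroup (symTensors m X))
instance : Module ℂ (SymTensorSymInj m X) := inferInstanceAs (Module ℂ (symTensors m X))

/-- The inclusion of `⊗^{m,s}_ε X` into `⊗ᵐ X`. -/
def SymTensorInj.incl : SymTensorInj m X →ₗ[ℂ] (⨂[ℂ] _ : Fin m, X) := (symTensors m X).subtype

/-- The inclusion of `⊗^{m,s}_{ε_s} X` into `⊗ᵐ X`. -/
def SymTensorSymInj.incl : SymTensorSymInj m X →ₗ[ℂ] (⨂[ℂ] _ : Fin m, X) :=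
  (symTensors m X).subtype

instance : Norm (SymTensorInj m X) := ⟨fun z => injNorm (SymTensorInj.incl m X z)⟩
instance : Norm (SymTensorSymInj m X) := ⟨fun z => symInjNorm (SymTensorSymInj.incl m X z)⟩

theorem SymTensorInj.norm_def (z : SymTensorInj m X) : ‖z‖ = injNorm (incl m X z) := rfl

theorem SymTensorSymInj.norm_def (z : SymTensorSymInj m X) : ‖z‖ = symInjNorm (incl m X z) := rfl

theorem SymTensorInj.core : NormedSpace.Core ℂ (SymTensorInj m X) where
  norm_nonneg z := injNorm_nonneg _
  norm_smul c z := by simp only [norm_def, map_smul, injNorm_smul]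
  norm_triangle z w := by simp only [norm_def, map_add]; exact injNorm_add_le _ _
  norm_eq_zero_iff z := by
    refine ⟨fun h => Subtype.ext (eq_zero_of_injNorm_eq_zero _ h), ?_⟩
    rintro rfl
    simp [norm_def, injNorm]

theorem SymTensorSymInj.core : NormedSpace.Core ℂ (SymTensorSymInj m X) where
  norm_nonneg z := symInjNorm_nonneg _
  norm_smul c z := by simp only [norm_def, map_smul, symInjNorm_smul]
  norm_triangle z w := by simp only [norm_def, map_add]; exact symInjNorm_add_le _ _
  norm_eq_zero_iff z := by
    refine ⟨fun h => Subtype.ext (eq_zero_of_symInjNorm_eq_zero _ z.2 h), ?_⟩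
    rintro rfl
    simp [norm_def, symInjNorm]

instance : NormedAddCommGroup (SymTensorInj m X) :=
  NormedAddCommGroup.ofCore (SymTensorInj.core m X)
instance : NormedSpace ℂ (SymTensorInj m X) := NormedSpace.ofCore (SymTensorInj.core m X)
instance : NormedAddCommGroup (SymTensorSymInj m X) :=
  NormedAddCommGroup.ofCore (SymTensorSymInj.core m X)
instance : NormedSpace ℂ (SymTensorSymInj m X) :=
  NormedSpace.ofCore (SymTensorSymInj.core m X)

end Spaces

end GordonLewis

end

/-!
The Gordon–Lewis constants of symmetric tensor powers are estimated by writing the identity of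
`Y = ⊗^{m,s} X` as a finite sum `z = ∑ₖ aₖ(z) vₖ` that is unconditional with a controlled constant
`K`. Such an expansion gives `gl(Y) ≤ K` (`gl_le_of_unconditional_expansion`): an operator
`T : Y → ℓ₂` is the composition of `z ↦ (aₖ(z) ‖T vₖ‖)ₖ ∈ ℓ₁` with `eₖ ↦ T vₖ / ‖T vₖ‖`, and
unconditionality bounds the first map by `K π₁(T)`.

To find the expansion, put `F = ⊗^{m-1,s} X` and let `(xⱼ)` be the unconditional basis.
Contracting one factor with `xⱼ*`, multiplying by `xⱼ` and symmetrizing gives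
`z = ∑ⱼ S(xⱼ ⊗ D(xⱼ*, z))` with `D(xⱼ*, z) ∈ F`. The space `F` need not have an unconditional basis.
But its identity factors through some `ℓ_∞ᴺ`, with constant essentially `2 λ(F)`: a `1/2`-net
`(φᵢ)` of the dual ball embeds `F` into `ℓ_∞ᴺ` with distortion `2`, and a projection of
`ℓ_∞(B_{F*})` onto `F` provides a left inverse `p`, because maps into `ℓ_∞` extend
(`exists_leftInverse_of_isProj`). Hence `z = ∑ᵢⱼ φᵢ(D(xⱼ*, z)) S(xⱼ ⊗ p(eᵢ))`, which is an
expansion along the unconditional basis `(eᵢ ⊗ xⱼ)` of `ℓ_∞ᴺ(X)` (`gl_le_mul_projConst`).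

For `ε` the contraction by a functional of norm one, multiplication and symmetrization all have
norm at most one. For `ε_s` only the contraction has to pass through `ε`, at the price of one
polarization constant `mᵐ / m!` (`injNorm_le_symInjNorm`).
-/

open scoped ENNReal NNReal TensorProduct

noncomputable section

namespace GordonLewis

universe u

/-! ### Factorization through `ℓ₁` -/

theorem sum_norm_le_oneSummingNorm {Y H ι : Type*} [NormedAddCommGroup Y] [NormedSpace ℂ Y]
    [NormedAddCommGroup H] [NormedSpace ℂ H] [Fintype ι] (T : Y →L[ℂ] H)
    (hT : oneSummingNorm T < ∞) (v : ι → Y) {r : ℝ} (hr : 0 ≤ r)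
    (hv : ∀ l : ι → ℂ, (∀ i, ‖l i‖ ≤ 1) → ‖∑ i, l i • v i‖ ≤ r) :
    ∑ i, ‖T (v i)‖ ≤ r * (oneSummingNorm T).toReal := by
  -- The family is rescaled by some `s > 0`, as `r` itself may vanish.
  have key : ∀ s : ℝ, 0 < s → r ≤ s → ∑ i, ‖T (v i)‖ ≤ s * (oneSummingNorm T).toReal := by
    intro s hs hrs
    let e := Fintype.equivFin ι
    let y : Fin (Fintype.card ι) → Y := fun k => ((s⁻¹ : ℝ) : ℂ) • v (e.symm k)
    have hy : ∀ l : Fin (Fintype.card ι) → ℂ, (∀ i, ‖l i‖ ≤ 1) → ‖∑ i, l i • y i‖ ≤ 1 := by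
      intro l hl
      have h1 : ∑ i, l i • y i = ((s⁻¹ : ℝ) : ℂ) • ∑ i, l (e i) • v i := by
        rw [Finset.smul_sum, ← e.sum_comp]
        exact Finset.sum_congr rfl fun i _ => by simp [y, smul_comm (l _)]
      rw [h1, norm_smul, Complex.norm_real, Real.norm_of_nonneg (by positivity),
        inv_mul_le_one₀ hs]
      exact (hv _ fun i => hl _).trans hrs
    have h2 : ∑ k, ‖T (y k)‖ₑ ≤ oneSummingNorm T :=
      le_iSup_of_le _ (le_iSup_of_le y (le_iSup_of_le hy le_rfl))
    have h3 := ENNReal.toReal_mono hT.ne h2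
    rw [ENNReal.toReal_sum (fun _ _ => enorm_ne_top)] at h3
    simp only [toReal_enorm, y, map_smul, norm_smul, Complex.norm_real] at h3
    rw [← Finset.mul_sum, e.symm.sum_comp (fun i => ‖T (v i)‖),
      Real.norm_of_nonneg (by positivity), inv_mul_le_iff₀ hs] at h3
    exact h3
  rcases hr.eq_or_lt with rfl | hr
  · refine le_of_forall_pos_le_add fun ε hε => ?_
    have hπ : 0 ≤ (oneSummingNorm T).toReal := ENNReal.toReal_nonneg
    refine (key (ε / (1 + (oneSummingNorm T).toReal)) (by positivity) (by positivity)).trans ?_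
    rw [zero_mul, zero_add, div_mul_eq_mul_div, div_le_iff₀ (by positivity)]
    nlinarith
  · exact key r hr le_rfl

section L1

open MeasureTheory

variable {κ : Type*} [MeasurableSpace κ] [MeasurableSingletonClass κ]

/-- Evaluation of an `L₁`-function at a point of a finite set with counting measure. -/
def evalL1 (k : κ) : Lp ℂ 1 (Measure.count : Measure κ) →ₗ[ℂ] ℂ where
  toFun f := f k
  map_add' f g := Measure.ae_count_iff.1 (Lp.coeFn_add f g) k
  map_smul' c f := Measure.ae_count_iff.1 (Lp.coeFn_smul c f) k

/-- The unit vector of `ℓ₁`, realized as `L₁` of the counting measure, at a point. -/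
def singleL1 (k : κ) : Lp ℂ 1 (Measure.count : Measure κ) :=
  indicatorConstLp 1 (MeasurableSet.singleton k) (by simp) 1

theorem norm_singleL1 (k : κ) : ‖singleL1 k‖ = 1 := by
  rw [singleL1, norm_indicatorConstLp one_ne_zero ENNReal.one_ne_top]
  simp [Measure.real]

theorem evalL1_singleL1 [DecidableEq κ] (j k : κ) :
    evalL1 k (singleL1 j) = if k = j then 1 else 0 := by
  have h := Measure.ae_count_iff.1 (indicatorConstLp_coeFn (p := 1)
    (hs := MeasurableSet.singleton j) (hμs := by simp) (c := (1 : ℂ))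
    (μ := (Measure.count : Measure κ))) k
  refine h.trans ?_
  simp [Set.indicator_apply]

theorem norm_eq_sum_evalL1 [Fintype κ] (f : Lp ℂ 1 (Measure.count : Measure κ)) :
    ‖f‖ = ∑ k, ‖evalL1 k f‖ := by
  rw [L1.norm_eq_integral_norm, integral_count]
  rfl

end L1

/-- A finite-rank representation `T = ∑ aₖ(·) wₖ` factors through `ℓ₁` by
`y ↦ (aₖ(y) ‖wₖ‖)ₖ` followed by `eₖ ↦ wₖ / ‖wₖ‖`. -/
theorem gammaOne_le_of_sum {Y : Type u} [NormedAddCommGroup Y] [NormedSpace ℂ Y]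
    {H : Type*} [NormedAddCommGroup H] [NormedSpace ℂ H] {ι : Type*} [Fintype ι]
    (T : Y →L[ℂ] H) (a : ι → Y →ₗ[ℂ] ℂ) (w : ι → H) {C : ℝ} (hC : 0 ≤ C)
    (hT : ∀ y, ∑ k, a k y • w k = T y)
    (hle : ∀ y, ∑ k, ‖a k y‖ * ‖w k‖ ≤ C * ‖y‖) :
    gammaOne T ≤ ENNReal.ofReal C := by
  classical
  -- the index set is moved to the universe over which `gammaOne` takes its infimum
  let κ : Type u := ULift.{u} (Fin (Fintype.card ι))
  let e : κ ≃ ι := Equiv.ulift.trans (Fintype.equivFin ι).symm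
  let _ : MeasurableSpace κ := ⊤
  have : MeasurableSingletonClass κ := ⟨fun _ => trivial⟩
  let μ : MeasureTheory.Measure κ := MeasureTheory.Measure.count
  let R₀ : Y →ₗ[ℂ] MeasureTheory.Lp ℂ 1 μ :=
    ∑ k : κ, ((‖w (e k)‖ : ℂ) • a (e k)).smulRight (singleL1 k)
  have hR₀ : ∀ y, R₀ y = ∑ k : κ, ((‖w (e k)‖ : ℂ) * a (e k) y) • singleL1 k := fun y => by
    simp [R₀, LinearMap.sum_apply]
  let R : Y →L[ℂ] MeasureTheory.Lp ℂ 1 μ := R₀.mkContinuous C fun y => by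
    rw [hR₀]
    refine (norm_sum_le _ _).trans (le_trans (le_of_eq ?_) (hle y))
    rw [← e.sum_comp]
    refine Finset.sum_congr rfl fun k _ => ?_
    rw [norm_smul, norm_singleL1, mul_one, norm_mul, Complex.norm_real, norm_norm, mul_comm]
  let S₀ : MeasureTheory.Lp ℂ 1 μ →ₗ[ℂ] H :=
    ∑ k : κ, (evalL1 k).smulRight ((‖w (e k)‖ : ℂ)⁻¹ • w (e k))
  have hS₀ : ∀ f, S₀ f = ∑ k : κ, evalL1 k f • ((‖w (e k)‖ : ℂ)⁻¹ • w (e k)) := fun f => by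
    simp [S₀, LinearMap.sum_apply]
  let S : MeasureTheory.Lp ℂ 1 μ →L[ℂ] H := S₀.mkContinuous 1 fun f => by
    rw [hS₀, one_mul, norm_eq_sum_evalL1]
    refine (norm_sum_le _ _).trans (Finset.sum_le_sum fun k _ => ?_)
    rw [norm_smul, norm_smul, norm_inv, Complex.norm_real, norm_norm]
    exact mul_le_of_le_one_right (norm_nonneg _) inv_mul_le_one
  have hSR : S.comp R = T := by
    ext1 y
    change S₀ (R₀ y) = T y
    rw [hR₀, hS₀, ← hT y, ← e.sum_comp]
    refine Finset.sum_congr rfl fun k _ => ?_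
    simp only [map_sum, map_smul, evalL1_singleL1, smul_eq_mul, mul_ite, mul_one, mul_zero]
    rw [Finset.sum_ite_eq, if_pos (Finset.mem_univ k)]
    rcases eq_or_ne (w (e k)) 0 with h | h
    · simp [h]
    · have : (‖w (e k)‖ : ℂ) ≠ 0 := by simpa using h
      rw [smul_smul]
      congr 1
      field_simp
  have hRn : ‖R‖ₑ ≤ ENNReal.ofReal C := by
    rw [← ofReal_norm]
    exact ENNReal.ofReal_le_ofReal (LinearMap.mkContinuous_norm_le _ hC _)
  have hSn : ‖S‖ₑ ≤ 1 := by
    rw [← ofReal_norm]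
    exact ENNReal.ofReal_le_one.2 (LinearMap.mkContinuous_norm_le _ zero_le_one _)
  calc gammaOne T ≤ ‖R‖ₑ * ‖S‖ₑ :=
        iInf_le_of_le κ (iInf_le_of_le ⊤ (iInf_le_of_le μ (iInf_le_of_le R
          (iInf_le_of_le S (iInf_le_of_le hSR le_rfl)))))
    _ ≤ ENNReal.ofReal C * 1 := mul_le_mul' hRn hSn
    _ = ENNReal.ofReal C := mul_one _

/-- If the identity of `Y` has a finite expansion `y = ∑ aₖ(y) vₖ` that is unconditional with
constant `K`, then `gl(Y) ≤ K`. -/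
theorem gl_le_of_unconditional_expansion {Y : Type u} [NormedAddCommGroup Y] [NormedSpace ℂ Y]
    {ι : Type*} [Fintype ι] (a : ι → Y →ₗ[ℂ] ℂ) (v : ι → Y) (K : ℝ≥0)
    (hav : ∀ y, ∑ k, a k y • v k = y)
    (hK : ∀ (l : ι → ℂ), (∀ k, ‖l k‖ ≤ 1) → ∀ y, ‖∑ k, l k • a k y • v k‖ ≤ K * ‖y‖) :
    gl Y ≤ K := by
  refine iInf_le_of_le K (iInf_le_of_le (fun T hT => ?_) le_rfl)
  have h := gammaOne_le_of_sum T a (fun k => T (v k))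
    (C := K * (oneSummingNorm T).toReal) (by positivity)
    (fun y => by conv_rhs => rw [← hav y, map_sum]; simp only [map_smul])
    (fun y => by
      have := sum_norm_le_oneSummingNorm T hT (fun k => a k y • v k) (r := K * ‖y‖)
        (by positivity) (fun l hl => hK l hl y)
      simp only [map_smul, norm_smul] at this
      linarith)
  rwa [ENNReal.ofReal_mul K.coe_nonneg, ENNReal.ofReal_toReal hT.ne,
    ENNReal.ofReal_coe_nnreal] at h

/-! ### Projection constants and factorization of the identity through `ℓ_∞ᴺ` -/

section Projection

variable {F : Type u} [NormedAddCommGroup F] [NormedSpace ℂ F]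

/-- Finitely many functionals in the dual unit ball of a finite dimensional space norm it up to
the factor `2`: a `1/2`-net of the dual ball will do. -/
theorem exists_almost_norming_functionals [FiniteDimensional ℂ F] :
    ∃ (N : ℕ) (φ : Fin N → StrongDual ℂ F), (∀ i, ‖φ i‖ ≤ 1) ∧
      ∀ f, ‖f‖ ≤ 2 * ‖fun i => φ i f‖ := by
  have : ProperSpace (StrongDual ℂ F) := FiniteDimensional.proper ℂ _
  obtain ⟨t, htB, htf, ht⟩ := Metric.finite_approx_of_totallyBounded
    (isCompact_closedBall (0 : StrongDual ℂ F) 1).totallyBounded (1 / 2) (by norm_num)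
  let _ := htf.fintype
  let e := Fintype.equivFin t
  refine ⟨_, fun i => (e.symm i : StrongDual ℂ F), fun i => ?_, fun f => ?_⟩
  · simpa using htB (e.symm i).2
  · obtain ⟨g, hg1, hgf⟩ := exists_dual_vector'' ℂ f
    obtain ⟨ψ, hψ, hgψ⟩ := Set.mem_iUnion₂.1 (ht (by simpa using hg1 : g ∈ _))
    rw [Metric.mem_ball, dist_eq_norm] at hgψ
    have h1 : ‖ψ f‖ ≤ ‖fun i => (e.symm i : StrongDual ℂ F) f‖ := by
      simpa using norm_le_pi_norm (fun i => (e.symm i : StrongDual ℂ F) f) (e ⟨ψ, hψ⟩)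
    have h2 : ‖f‖ ≤ ‖(g - ψ) f‖ + ‖ψ f‖ := by
      have : ‖g f‖ = ‖f‖ := by rw [hgf]; simp
      rw [← this]
      simpa using norm_add_le ((g - ψ) f) (ψ f)
    have h3 := (g - ψ).le_of_opNorm_le hgψ.le f
    linarith

/-- Hahn–Banach: functionals extend along an injection that is bounded below. -/
theorem exists_extension_of_norm_le {E : Type*} [NormedAddCommGroup E] [NormedSpace ℂ E]
    (j : F →ₗ[ℂ] E) {C : ℝ} (hC : 0 ≤ C) (hj : ∀ f, ‖f‖ ≤ C * ‖j f‖) (φ : StrongDual ℂ F)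
    (hφ : ‖φ‖ ≤ 1) : ∃ g : StrongDual ℂ E, ‖g‖ ≤ C ∧ ∀ f, g (j f) = φ f := by
  have hinj : Function.Injective j := (injective_iff_map_eq_zero j).2 fun f hf => by
    simpa [hf] using hj f
  let e := LinearEquiv.ofInjective j hinj
  let ψ : StrongDual ℂ (LinearMap.range j) :=
    ((φ : F →ₗ[ℂ] ℂ).comp e.symm.toLinearMap).mkContinuous C fun z => by
      obtain ⟨f, rfl⟩ := e.surjective z
      simpa [e] using (φ.le_of_opNorm_le hφ f).trans (by simpa using hj f)
  obtain ⟨g, hg, hgn⟩ := exists_extension_norm_eq (LinearMap.range j) ψ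
  refine ⟨g, hgn.le.trans (LinearMap.mkContinuous_norm_le _ hC _), fun f => ?_⟩
  refine (hg (e f)).trans ?_
  simp [ψ]

variable (F) in
/-- The canonical embedding of `F` into `ℓ_∞` over the unit ball of its dual. -/
def dualBallEmbedding : F →ₗᵢ[ℂ] lp (fun _ : {φ : StrongDual ℂ F // ‖φ‖ ≤ 1} => ℂ) ∞ where
  toFun f := ⟨fun φ => φ.1 f, memℓp_infty ⟨‖f‖, by
    rintro _ ⟨φ, rfl⟩
    simpa using φ.1.le_of_opNorm_le φ.2 f⟩⟩
  map_add' f g := by ext φ; exact map_add φ.1 f g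
  map_smul' c f := by ext φ; simp
  norm_map' f := by
    refine le_antisymm (lp.norm_le_of_forall_le (norm_nonneg f) fun φ => ?_) ?_
    · simpa using φ.1.le_of_opNorm_le φ.2 f
    · obtain ⟨g, hg1, hgf⟩ := exists_dual_vector'' ℂ f
      refine le_trans (le_of_eq ?_) (lp.norm_apply_le_norm (by simp) _ ⟨g, hg1⟩)
      simp [hgf]

/-- A projection `Q` onto the canonical copy of `F` in `ℓ_∞` turns every injection of `F` into a
normed space `E` that is bounded below into a complemented one: the inverse extends to a map
`E → ℓ_∞` coordinate by coordinate, which is then composed with `Q`. -/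
theorem exists_leftInverse_of_isProj {E : Type*} [NormedAddCommGroup E] [NormedSpace ℂ E]
    (j : F →ₗ[ℂ] E) {C : ℝ} (hC : 0 ≤ C) (hj : ∀ f, ‖f‖ ≤ C * ‖j f‖)
    (Q : lp (fun _ : {φ : StrongDual ℂ F // ‖φ‖ ≤ 1} => ℂ) ∞ →L[ℂ]
      lp (fun _ : {φ : StrongDual ℂ F // ‖φ‖ ≤ 1} => ℂ) ∞)
    (hQ : LinearMap.IsProj (LinearMap.range (dualBallEmbedding F).toLinearMap) Q) :
    ∃ p : E →ₗ[ℂ] F, (∀ z, ‖p z‖ ≤ C * ‖Q‖ * ‖z‖) ∧ ∀ f, p (j f) = f := by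
  choose g hgn hgj using fun φ : {φ : StrongDual ℂ F // ‖φ‖ ≤ 1} =>
    exists_extension_of_norm_le j hC hj φ.1 φ.2
  have hb : ∀ z φ, ‖g φ z‖ ≤ C * ‖z‖ := fun z φ => (g φ).le_of_opNorm_le (hgn φ) z
  let G : E →ₗ[ℂ] lp (fun _ : {φ : StrongDual ℂ F // ‖φ‖ ≤ 1} => ℂ) ∞ :=
    { toFun := fun z => ⟨fun φ => g φ z, memℓp_infty ⟨C * ‖z‖, by
        rintro _ ⟨φ, rfl⟩
        exact hb z φ⟩⟩
      map_add' := fun y z => by ext φ; exact map_add (g φ) y z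
      map_smul' := fun c z => by ext φ; simp }
  have hGj : ∀ f, G (j f) = dualBallEmbedding F f := fun f => by
    ext φ
    exact hgj φ f
  let e := LinearEquiv.ofInjective (dualBallEmbedding F).toLinearMap
    (dualBallEmbedding F).injective
  have he : ∀ f, (e f : lp (fun _ : {φ : StrongDual ℂ F // ‖φ‖ ≤ 1} => ℂ) ∞) =
    dualBallEmbedding F f := fun f => rfl
  let p : E →ₗ[ℂ] F := e.symm.toLinearMap ∘ₗ
    (((Q : _ →ₗ[ℂ] _) ∘ₗ G).codRestrict _ fun z => hQ.map_mem (G z))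
  have hp : ∀ z, dualBallEmbedding F (p z) = Q (G z) := fun z => by
    rw [← he]
    simp [p]
  refine ⟨p, fun z => ?_, fun f => (dualBallEmbedding F).injective ?_⟩
  · rw [← (dualBallEmbedding F).norm_map, hp]
    have hGz : ‖G z‖ ≤ C * ‖z‖ := lp.norm_le_of_forall_le (by positivity) (hb z)
    calc ‖Q (G z)‖ ≤ ‖Q‖ * ‖G z‖ := Q.le_opNorm _
      _ ≤ ‖Q‖ * (C * ‖z‖) := by gcongr
      _ = C * ‖Q‖ * ‖z‖ := by ring
  · rw [hp, hGj]
    exact hQ.map_id _ ⟨f, rfl⟩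

/-- To bound a quantity by a multiple of `λ(F)` it is enough to bound it by the norms of the
projections onto the canonical copy of `F` in `ℓ_∞`. -/
theorem le_mul_projConst {b K : ℝ≥0∞} (hK : K ≠ 0) (hK' : K ≠ ∞)
    (h : ∀ Q : lp (fun _ : {φ : StrongDual ℂ F // ‖φ‖ ≤ 1} => ℂ) ∞ →L[ℂ]
      lp (fun _ : {φ : StrongDual ℂ F // ‖φ‖ ≤ 1} => ℂ) ∞,
      LinearMap.IsProj (LinearMap.range (dualBallEmbedding F).toLinearMap) Q →
        b ≤ K * ‖Q‖ₑ) : b ≤ K * projConst F := by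
  have h1 : b ≤ K * relProjConst (LinearMap.range (dualBallEmbedding F).toLinearMap) := by
    simp only [relProjConst, ENNReal.mul_iInf_of_ne hK hK']
    exact le_iInf₂ h
  refine h1.trans (mul_le_mul_right ?_ _)
  exact le_iSup_of_le _ (le_iSup_of_le _ (le_iSup_of_le _ (le_iSup_of_le inferInstance
    (le_iSup_of_le (dualBallEmbedding F) le_rfl))))

end Projection

/-- Let `D : X* × Y → F` and `M : X × F → Y` be bilinear, to be thought of as the contraction of
one factor and the product with one factor. If `M` is bounded for the injective norm, `D` has
norm at most `a`, and `z = ∑ⱼ M(xⱼ, D(xⱼ*, z))` for a `1`-unconditional basis `(xⱼ)` of `X`, then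
`gl(Y) ≤ 2 a λ(F)`. -/
theorem gl_le_mul_projConst {X : Type*} [NormedAddCommGroup X] [NormedSpace ℂ X]
    {F Y : Type u} [NormedAddCommGroup F] [NormedSpace ℂ F] [FiniteDimensional ℂ F]
    [NormedAddCommGroup Y] [NormedSpace ℂ Y] {n : ℕ}
    (x : Module.Basis (Fin n) ℂ X) (hx : IsOneUnconditional x)
    (D : Module.Dual ℂ X →ₗ[ℂ] Y →ₗ[ℂ] F) (M : X →ₗ[ℂ] F →ₗ[ℂ] Y) {a : ℝ≥0} (ha : a ≠ 0)
    (hD : ∀ φ : StrongDual ℂ X, ‖φ‖ ≤ 1 → ∀ z, ‖D (φ : X →ₗ[ℂ] ℂ) z‖ ≤ a * ‖z‖)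
    (hM : ∀ (N : ℕ) (y : Fin N → X) (f : Fin N → F) (c : ℝ), 0 ≤ c →
      (∀ l : Fin N → ℂ, ‖∑ i, l i • f i‖ ≤ c * ‖l‖) → ‖∑ i, M (y i) (f i)‖ ≤ c * ‖y‖)
    (hMD : ∀ z, ∑ j, M (x j) (D (x.coord j) z) = z) :
    gl Y ≤ 2 * a * projConst F := by
  refine le_mul_projConst (by simp [ha]) (by finiteness) fun Q hQ => ?_
  obtain ⟨N, φ, hφ, hnorm⟩ := exists_almost_norming_functionals (F := F)
  obtain ⟨p, hp, hpφ⟩ := exists_leftInverse_of_isProj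
    (LinearMap.pi fun i => (φ i : F →ₗ[ℂ] ℂ)) zero_le_two hnorm Q hQ
  have hpsum : ∀ l : Fin N → ℂ, ∑ i, l i • p (Pi.single i 1) = p l := fun l => by
    conv_rhs => rw [pi_eq_sum_univ' l]
    simp only [map_sum, map_smul]
  have hDy : ∀ z i, ‖∑ j, φ i (D (x.coord j) z) • x j‖ ≤ a * ‖z‖ := fun z i => by
    obtain ⟨ψ, hψ, hψx⟩ := exists_dual_vector'' ℂ (∑ j, φ i (D (x.coord j) z) • x j)
    have hψc : (ψ : X →ₗ[ℂ] ℂ) = ∑ j, ψ (x j) • x.coord j := x.ext fun k => by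
      simp [LinearMap.sum_apply, Finsupp.single_apply]
    have h1 : ψ (∑ j, φ i (D (x.coord j) z) • x j) = φ i (D (ψ : X →ₗ[ℂ] ℂ) z) := by
      rw [hψc]
      simp [LinearMap.sum_apply, mul_comm]
    have h2 : ‖∑ j, φ i (D (x.coord j) z) • x j‖ = ‖φ i (D (ψ : X →ₗ[ℂ] ℂ) z)‖ := by
      rw [← h1, hψx]; simp
    rw [h2]
    exact ((φ i).le_of_opNorm_le (hφ i) _).trans (by simpa using hD ψ hψ z)
  have hMD' : ∀ (l : Fin N × Fin n → ℂ) (z : Y),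
      ∑ k : Fin N × Fin n, l k • φ k.1 (D (x.coord k.2) z) • M (x k.2) (p (Pi.single k.1 1)) =
        ∑ i, M (∑ j, (l (i, j) * φ i (D (x.coord j) z)) • x j) (p (Pi.single i 1)) := by
    intro l z
    simp [Fintype.sum_prod_type, LinearMap.sum_apply, smul_smul]
  have hgl := gl_le_of_unconditional_expansion (Y := Y) (ι := Fin N × Fin n)
    (fun k => (φ k.1 : F →ₗ[ℂ] ℂ) ∘ₗ D (x.coord k.2))
    (fun k => M (x k.2) (p (Pi.single k.1 1))) (2 * a * ‖Q‖₊) (fun z => ?_) (fun l hl z => ?_)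
  · simpa [enorm] using hgl
  · simp only [LinearMap.comp_apply, ContinuousLinearMap.coe_coe]
    rw [Fintype.sum_prod_type, Finset.sum_comm]
    conv_rhs => rw [← hMD z]
    refine Finset.sum_congr rfl fun j _ => ?_
    simp only [← map_smul (M (x j)), ← map_sum (M (x j))]
    rw [hpsum fun i => φ i (D (x.coord j) z)]
    exact congrArg _ (hpφ _)
  · refine (congrArg _ (hMD' l z)).trans_le ?_
    refine (hM N _ _ (2 * ‖Q‖) (by positivity) fun l => (hpsum l).symm ▸ hp l).trans ?_
    have : ‖fun i => ∑ j, (l (i, j) * φ i (D (x.coord j) z)) • x j‖ ≤ a * ‖z‖ :=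
      (pi_norm_le_iff_of_nonneg (by positivity)).2 fun i =>
        (hx _ (fun j => l (i, j)) fun j => hl _).trans (hDy z i)
    calc _ ≤ 2 * ‖Q‖ * (a * ‖z‖) := by gcongr
      _ = _ := by push_cast; ring

/-! ### Contraction and multiplication in symmetric tensor powers -/

section SymmetricTensors

variable {m k : ℕ} {X : Type u} [NormedAddCommGroup X] [NormedSpace ℂ X]

theorem tensorEval_symmetrizer (φ : Fin m → StrongDual ℂ X) (z : ⨂[ℂ] _ : Fin m, X) :
    tensorEval φ (symmetrizer m X z) =
      ((m.factorial : ℂ)⁻¹) * ∑ σ : Equiv.Perm (Fin m), tensorEval (fun i => φ (σ i)) z := by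
  simp [symmetrizer, LinearMap.sum_apply, tensorEval_reindex]

theorem eq_of_tensorEval {z w : ⨂[ℂ] _ : Fin m, X}
    (h : ∀ φ : Fin m → StrongDual ℂ X, tensorEval φ z = tensorEval φ w) : z = w :=
  sub_eq_zero.1 (eq_zero_of_tensorEval _ fun φ => by rw [map_sub, h, sub_self])

theorem symmetrizer_eq_self {z : ⨂[ℂ] _ : Fin m, X}
    (h : ∀ (σ : Equiv.Perm (Fin m)) (φ : Fin m → StrongDual ℂ X),
      tensorEval (fun i => φ (σ i)) z = tensorEval φ z) : symmetrizer m X z = z := by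
  refine eq_of_tensorEval fun φ => ?_
  rw [tensorEval_symmetrizer]
  have : (m.factorial : ℂ) ≠ 0 := by exact_mod_cast m.factorial_ne_zero
  simp [h, Fintype.card_perm, this]

theorem tensorEval_perm_of_mem {z : ⨂[ℂ] _ : Fin m, X} (hz : z ∈ symTensors m X)
    (σ : Equiv.Perm (Fin m)) (φ : Fin m → StrongDual ℂ X) :
    tensorEval (fun i => φ (σ i)) z = tensorEval φ z := by
  obtain ⟨w, rfl⟩ := hz
  simp only [tensorEval_symmetrizer]
  congr 1
  exact Fintype.sum_equiv (Equiv.mulLeft σ) _ _ fun τ => rfl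

variable (k X) in
/-- The contraction `y₀ ⊗ ⋯ ⊗ y_k ↦ φ(y₀) y₁ ⊗ ⋯ ⊗ y_k` of the first factor. -/
def contractFirst : Module.Dual ℂ X →ₗ[ℂ]
    (⨂[ℂ] _ : Fin (k + 1), X) →ₗ[ℂ] (⨂[ℂ] _ : Fin k, X) where
  toFun φ := PiTensorProduct.lift (LinearMap.uncurryLeft (M := fun _ => X)
    (LinearMap.smulRight φ (PiTensorProduct.tprod ℂ (s := fun _ : Fin k => X))))
  map_add' φ ψ := by ext y; simp [add_smul]
  map_smul' c φ := by ext y; simp [mul_smul]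

@[simp]
theorem contractFirst_tprod (φ : Module.Dual ℂ X) (y : Fin (k + 1) → X) :
    contractFirst k X φ (PiTensorProduct.tprod ℂ y) =
      φ (y 0) • PiTensorProduct.tprod ℂ (Fin.tail y) := by
  simp [contractFirst]

variable (k X) in
/-- The product `(x, y₁ ⊗ ⋯ ⊗ y_k) ↦ x ⊗ y₁ ⊗ ⋯ ⊗ y_k`. -/
def tensorCons : X →ₗ[ℂ] (⨂[ℂ] _ : Fin k, X) →ₗ[ℂ] (⨂[ℂ] _ : Fin (k + 1), X) :=
  PiTensorProduct.lift.toLinearMap ∘ₗ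
    (PiTensorProduct.tprod ℂ (s := fun _ : Fin (k + 1) => X)).curryLeft

@[simp]
theorem tensorCons_tprod (x : X) (y : Fin k → X) :
    tensorCons k X x (PiTensorProduct.tprod ℂ y) =
      PiTensorProduct.tprod ℂ (Fin.cons x y : Fin (k + 1) → X) := by
  simp [tensorCons]

theorem tensorEval_contractFirst (φ : StrongDual ℂ X) (ψ : Fin k → StrongDual ℂ X)
    (z : ⨂[ℂ] _ : Fin (k + 1), X) :
    tensorEval ψ (contractFirst k X (φ : X →ₗ[ℂ] ℂ) z) =
      tensorEval (Fin.cons φ ψ : Fin (k + 1) → StrongDual ℂ X) z := by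
  induction z using PiTensorProduct.induction_on with
  | smul_tprod r y => simp [Fin.prod_univ_succ, Fin.tail]
  | add x y hx hy => simp only [map_add, hx, hy]

theorem tensorEval_tensorCons (φ : Fin (k + 1) → StrongDual ℂ X) (x : X)
    (z : ⨂[ℂ] _ : Fin k, X) :
    tensorEval φ (tensorCons k X x z) = φ 0 x * tensorEval (Fin.tail φ) z := by
  induction z using PiTensorProduct.induction_on with
  | smul_tprod r y => simp [Fin.prod_univ_succ, Fin.tail, mul_left_comm]
  | add x y hx hy => simp only [map_add, hx, hy, mul_add]

theorem sum_tensorCons_contractFirst {n : ℕ} (x : Module.Basis (Fin n) ℂ X)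
    (z : ⨂[ℂ] _ : Fin (k + 1), X) :
    ∑ j, tensorCons k X (x j) (contractFirst k X (x.coord j) z) = z := by
  induction z using PiTensorProduct.induction_on with
  | smul_tprod r y =>
    have h : ∑ j, x.coord j (y 0) • tensorCons k X (x j) (PiTensorProduct.tprod ℂ (Fin.tail y)) =
        PiTensorProduct.tprod ℂ y := by
      have h0 : ∑ j, x.coord j (y 0) • x j = y 0 := x.sum_repr (y 0)
      rw [← Fin.cons_self_tail y, ← tensorCons_tprod, Fin.cons_zero, Fin.tail_cons]
      conv_rhs => rw [← h0]
      simp only [map_sum, map_smul, LinearMap.sum_apply, LinearMap.smul_apply]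
    simp only [map_smul, contractFirst_tprod, ← Finset.smul_sum, h]
  | add x y hx hy => simp only [map_add, Finset.sum_add_distrib, hx, hy]

theorem contractFirst_mem_symTensors {z : ⨂[ℂ] _ : Fin (k + 1), X}
    (hz : z ∈ symTensors (k + 1) X) (φ : StrongDual ℂ X) :
    contractFirst k X (φ : X →ₗ[ℂ] ℂ) z ∈ symTensors k X := by
  refine ⟨_, symmetrizer_eq_self fun σ ψ => ?_⟩
  rw [tensorEval_contractFirst, tensorEval_contractFirst,
    ← tensorEval_perm_of_mem hz (Equiv.Perm.decomposeFin.symm (0, σ)) (Fin.cons φ ψ)]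
  congr 2
  funext i
  refine Fin.cases ?_ (fun i => ?_) i <;> simp

theorem norm_tensorEval_diag_le (z : ⨂[ℂ] _ : Fin m, X) {ψ : StrongDual ℂ X} {r : ℝ}
    (hψ : ‖ψ‖ ≤ r) : ‖tensorEval (fun _ : Fin m => ψ) z‖ ≤ r ^ m * symInjNorm z := by
  have hr : 0 ≤ r := (norm_nonneg _).trans hψ
  obtain ⟨χ, hχ, rfl⟩ : ∃ χ : StrongDual ℂ X, ‖χ‖ ≤ 1 ∧ ψ = (r : ℂ) • χ := by
    rcases hr.eq_or_lt with rfl | hr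
    · exact ⟨0, by simp, by rw [norm_le_zero_iff.1 hψ]; ext v; simp⟩
    · refine ⟨(r : ℂ)⁻¹ • ψ, ?_, (smul_inv_smul₀ (by exact_mod_cast hr.ne') ψ).symm⟩
      rw [norm_smul, norm_inv, Complex.norm_real, Real.norm_of_nonneg hr.le]
      exact (inv_mul_le_one₀ hr).2 hψ
  rw [tensorEval_smul, norm_mul, norm_pow, Complex.norm_real, Real.norm_of_nonneg hr]
  gcongr
  exact norm_tensorEval_le_symInjNorm z χ hχ

/-- Polarization: on symmetric tensors `2ᵐ m! φ₁ ⊗ ⋯ ⊗ φ_m` is a signed sum of the `2ᵐ`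
functionals `ψ ⊗ ⋯ ⊗ ψ` with `ψ = ∑ ± φᵢ`, and `‖ψ‖ ≤ m`. -/
theorem injNorm_le_symInjNorm {z : ⨂[ℂ] _ : Fin m, X} (hz : z ∈ symTensors m X) :
    injNorm z ≤ (m : ℝ) ^ m / m.factorial * symInjNorm z := by
  classical
  refine ciSup_le fun ⟨φ, hφ⟩ => ?_
  have hcard : (Finset.univ.filter fun p : Fin m → Fin m => Function.Bijective p).card =
      m.factorial := by
    rw [← Fintype.card_subtype, Fintype.card_congr Equiv.bijectiveEquiv, Fintype.card_perm,
      Fintype.card_fin]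
  have h0 : ∑ e : Fin m → Fin 2, (∏ k, (-1 : ℂ) ^ (e k : ℕ)) *
      tensorEval (fun _ : Fin m => ∑ k, ((-1 : ℂ) ^ (e k : ℕ)) • φ k) z =
        2 ^ m * (m.factorial * tensorEval φ z) := by
    simp only [tensorEval_sum, Finset.mul_sum, ← mul_assoc]
    rw [Finset.sum_comm]
    simp only [← Finset.sum_mul, sum_sign_prod, ite_mul, zero_mul]
    rw [← Finset.sum_filter, Finset.sum_congr rfl (g := fun _ => 2 ^ m * tensorEval φ z),
      Finset.sum_const, hcard, nsmul_eq_mul]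
    · ring
    · intro p hp
      congr 1
      exact tensorEval_perm_of_mem hz (Equiv.ofBijective p (Finset.mem_filter.1 hp).2) φ
  have hbound : ∀ e : Fin m → Fin 2, ‖(∏ k, (-1 : ℂ) ^ (e k : ℕ)) *
      tensorEval (fun _ : Fin m => ∑ k, ((-1 : ℂ) ^ (e k : ℕ)) • φ k) z‖ ≤
        (m : ℝ) ^ m * symInjNorm z := by
    intro e
    rw [norm_mul, norm_prod]
    simp only [norm_pow, norm_neg, norm_one, one_pow, Finset.prod_const_one, one_mul]
    refine norm_tensorEval_diag_le z ((norm_sum_le _ _).trans ?_)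
    refine (Finset.sum_le_sum (g := fun _ => (1 : ℝ)) fun k _ => ?_).trans (by simp)
    simpa [norm_smul] using hφ k
  have h1 : (2 : ℝ) ^ m * (m.factorial * ‖tensorEval φ z‖) ≤
      2 ^ m * ((m : ℝ) ^ m * symInjNorm z) := by
    calc (2 : ℝ) ^ m * (m.factorial * ‖tensorEval φ z‖)
        = ‖(2 : ℂ) ^ m * (m.factorial * tensorEval φ z)‖ := by simp
      _ ≤ ∑ _e : Fin m → Fin 2, (m : ℝ) ^ m * symInjNorm z := by
        rw [← h0]
        exact (norm_sum_le _ _).trans (Finset.sum_le_sum fun e _ => hbound e)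
      _ = _ := by simp
  rw [div_mul_eq_mul_div, le_div_iff₀ (by positivity), mul_comm]
  exact le_of_mul_le_mul_left h1 (by positivity)

theorem injNorm_contractFirst_le {φ : StrongDual ℂ X} (hφ : ‖φ‖ ≤ 1)
    (z : ⨂[ℂ] _ : Fin (k + 1), X) :
    injNorm (contractFirst k X (φ : X →ₗ[ℂ] ℂ) z) ≤ injNorm z := by
  refine ciSup_le fun ψ => ?_
  rw [tensorEval_contractFirst]
  refine norm_tensorEval_le_injNorm z _ fun i => ?_
  refine Fin.cases ?_ (fun i => ?_) i
  · simpa using hφ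
  · simpa using ψ.2 i

theorem symInjNorm_le_injNorm (z : ⨂[ℂ] _ : Fin m, X) : symInjNorm z ≤ injNorm z :=
  ciSup_le fun φ => norm_tensorEval_le_injNorm z _ fun _ => φ.2

theorem injNorm_symmetrizer_le (z : ⨂[ℂ] _ : Fin m, X) :
    injNorm (symmetrizer m X z) ≤ injNorm z := by
  refine ciSup_le fun φ => ?_
  rw [tensorEval_symmetrizer, norm_mul, norm_inv, Complex.norm_natCast,
    inv_mul_le_iff₀ (by positivity)]
  have h : ∀ σ : Equiv.Perm (Fin m), ‖tensorEval (fun i => φ.1 (σ i)) z‖ ≤ injNorm z :=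
    fun σ => norm_tensorEval_le_injNorm z _ fun i => φ.2 (σ i)
  refine (norm_sum_le _ _).trans ((Finset.sum_le_sum fun σ _ => h σ).trans_eq ?_)
  rw [Finset.sum_const, Finset.card_univ, Fintype.card_perm, Fintype.card_fin, nsmul_eq_mul]

/-- `φ ⊗ ⋯ ⊗ φ` does not see the order of the factors, so `ε_s` is invariant under
symmetrization. -/
theorem symInjNorm_symmetrizer (z : ⨂[ℂ] _ : Fin m, X) :
    symInjNorm (symmetrizer m X z) = symInjNorm z := by
  have : (m.factorial : ℂ) ≠ 0 := by exact_mod_cast m.factorial_ne_zero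
  simp [symInjNorm, tensorEval_symmetrizer, Fintype.card_perm, this]

theorem tensorEval_sum_tensorCons {N : ℕ} (φ : Fin (k + 1) → StrongDual ℂ X) (y : Fin N → X)
    (f : Fin N → ⨂[ℂ] _ : Fin k, X) :
    tensorEval φ (∑ i, tensorCons k X (y i) (f i)) =
      tensorEval (Fin.tail φ) (∑ i, φ 0 (y i) • f i) := by
  simp [tensorEval_tensorCons]

theorem norm_apply_family_le {N : ℕ} {φ : StrongDual ℂ X} (hφ : ‖φ‖ ≤ 1) (y : Fin N → X) :
    ‖fun i => φ (y i)‖ ≤ ‖y‖ :=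
  (pi_norm_le_iff_of_nonneg (norm_nonneg y)).2 fun i =>
    (φ.le_of_opNorm_le hφ (y i)).trans (by simpa using norm_le_pi_norm y i)

theorem injNorm_sum_tensorCons_le {N : ℕ} (y : Fin N → X) (f : Fin N → ⨂[ℂ] _ : Fin k, X)
    {c : ℝ} (hc : 0 ≤ c) (h : ∀ l : Fin N → ℂ, injNorm (∑ i, l i • f i) ≤ c * ‖l‖) :
    injNorm (∑ i, tensorCons k X (y i) (f i)) ≤ c * ‖y‖ := by
  refine ciSup_le fun φ => ?_
  rw [tensorEval_sum_tensorCons]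
  refine (norm_tensorEval_le_injNorm _ _ fun i => φ.2 i.succ).trans ((h _).trans ?_)
  gcongr
  exact norm_apply_family_le (φ.2 0) y

theorem symInjNorm_sum_tensorCons_le {N : ℕ} (y : Fin N → X)
    (f : Fin N → ⨂[ℂ] _ : Fin k, X)
    {c : ℝ} (hc : 0 ≤ c) (h : ∀ l : Fin N → ℂ, symInjNorm (∑ i, l i • f i) ≤ c * ‖l‖) :
    symInjNorm (∑ i, tensorCons k X (y i) (f i)) ≤ c * ‖y‖ := by
  refine ciSup_le fun φ => ?_
  rw [tensorEval_sum_tensorCons]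
  refine (norm_tensorEval_le_symInjNorm _ _ φ.2).trans ((h _).trans ?_)
  gcongr
  exact norm_apply_family_le φ.2 y

variable (k X) in
/-- The symmetric product `(x, f) ↦ S(x ⊗ f)`, where `S` is the symmetrization operator. -/
def symCons : X →ₗ[ℂ] symTensors k X →ₗ[ℂ] symTensors (k + 1) X :=
  ((tensorCons k X).compr₂ (symmetrizer (k + 1) X).rangeRestrict).compl₂ (symTensors k X).subtype

theorem coe_symCons (x : X) (f : symTensors k X) :
    (symCons k X x f : ⨂[ℂ] _ : Fin (k + 1), X) = symmetrizer (k + 1) X (tensorCons k X x f) := rfl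

variable (k X) in
/-- The contraction of one factor of a symmetric tensor. -/
def symContract [FiniteDimensional ℂ X] :
    Module.Dual ℂ X →ₗ[ℂ] symTensors (k + 1) X →ₗ[ℂ] symTensors k X where
  toFun φ := (contractFirst k X φ).restrict fun _ hz =>
    contractFirst_mem_symTensors hz (LinearMap.toContinuousLinearMap φ)
  map_add' φ ψ := by
    ext1 z
    exact Subtype.ext (by simp only [map_add]; rfl)
  map_smul' c φ := by
    ext1 z
    exact Subtype.ext (by simp only [map_smul]; rfl)

theorem coe_symContract [FiniteDimensional ℂ X] (φ : Module.Dual ℂ X)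
    (z : symTensors (k + 1) X) :
    (symContract k X φ z : ⨂[ℂ] _ : Fin k, X) = contractFirst k X φ z := rfl

theorem sum_symCons_symContract [FiniteDimensional ℂ X] {n : ℕ} (x : Module.Basis (Fin n) ℂ X)
    (z : symTensors (k + 1) X) : ∑ j, symCons k X (x j) (symContract k X (x.coord j) z) = z := by
  ext1
  simp only [AddSubmonoidClass.coe_finsetSum, coe_symCons, coe_symContract, ← map_sum]
  rw [sum_tensorCons_contractFirst]
  exact symmetrizer_eq_self (tensorEval_perm_of_mem z.2)

end SymmetricTensors

/-! ### The Gordon–Lewis constants of symmetric tensor powers -/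

section GordonLewisConstants

variable {X : Type u} [NormedAddCommGroup X] [NormedSpace ℂ X] {n : ℕ}

instance (m : ℕ) [FiniteDimensional ℂ X] : FiniteDimensional ℂ (SymTensorInj m X) :=
  inferInstanceAs (FiniteDimensional ℂ (symTensors m X))

instance (m : ℕ) [FiniteDimensional ℂ X] : FiniteDimensional ℂ (SymTensorSymInj m X) :=
  inferInstanceAs (FiniteDimensional ℂ (symTensors m X))

theorem gl_symTensorInj_le (x : Module.Basis (Fin n) ℂ X) (hx : IsOneUnconditional x) (k : ℕ) :
    gl (SymTensorInj (k + 1) X) ≤ 2 * projConst (SymTensorInj k X) := by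
  have : FiniteDimensional ℂ X := x.finiteDimensional_of_finite
  have h := gl_le_mul_projConst (F := SymTensorInj k X) (Y := SymTensorInj (k + 1) X) x hx
    (symContract k X) (symCons k X) (a := 1) one_ne_zero (fun φ hφ z => ?_)
    (fun N y f c hc hf => ?_) (sum_symCons_symContract x)
  · simpa using h
  · rw [NNReal.coe_one, one_mul]
    exact injNorm_contractFirst_le hφ (SymTensorInj.incl _ X z)
  · simp only [SymTensorInj.norm_def, map_sum, map_smul] at hf ⊢
    refine le_trans (le_of_eq_of_le ?_ (injNorm_symmetrizer_le _))
      (injNorm_sum_tensorCons_le y (fun i => SymTensorInj.incl k X (f i)) hc hf)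
    rw [map_sum]
    rfl

theorem gl_symTensorSymInj_le (x : Module.Basis (Fin n) ℂ X) (hx : IsOneUnconditional x)
    (k : ℕ) :
    gl (SymTensorSymInj (k + 1) X) ≤
      2 * (((k + 1 : ℕ) : ℝ≥0∞) ^ (k + 1) / ((k + 1).factorial : ℝ≥0∞)) *
        projConst (SymTensorSymInj k X) := by
  have : FiniteDimensional ℂ X := x.finiteDimensional_of_finite
  have h := gl_le_mul_projConst (F := SymTensorSymInj k X) (Y := SymTensorSymInj (k + 1) X) x hx
    (symContract k X) (symCons k X)
    (a := ((k + 1 : ℕ) : ℝ≥0) ^ (k + 1) / ((k + 1).factorial : ℝ≥0)) (by positivity)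
    (fun φ hφ z => ?_) (fun N y f c hc hf => ?_) (sum_symCons_symContract x)
  · rw [ENNReal.coe_div (by positivity)] at h
    simpa using h
  · exact (symInjNorm_le_injNorm _).trans ((injNorm_contractFirst_le hφ _).trans
      ((injNorm_le_symInjNorm z.2).trans_eq (by push_cast; rfl)))
  · simp only [SymTensorSymInj.norm_def, map_sum, map_smul] at hf ⊢
    refine le_of_eq_of_le ?_
      (symInjNorm_sum_tensorCons_le y (fun i => SymTensorSymInj.incl k X (f i)) hc hf)
    rw [← symInjNorm_symmetrizer (∑ i, tensorCons k X _ _), map_sum]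
    rfl

end GordonLewisConstants

end GordonLewis

end

theorem proposition5p1 {X : Type*} [NormedAddCommGroup X] [NormedSpace ℂ X] {n : ℕ}
    (x : Module.Basis (Fin n) ℂ X) (hx : GordonLewis.IsOneUnconditional x)
    (m : ℕ) (hm : 2 ≤ m) :
    GordonLewis.gl (GordonLewis.SymTensorInj m X) ≤
        2 * GordonLewis.projConst (GordonLewis.SymTensorInj (m - 1) X) ∧
      GordonLewis.gl (GordonLewis.SymTensorSymInj m X) ≤
        2 * ((m : ENNReal) ^ m / (m.factorial : ENNReal)) ^ 2 *
          GordonLewis.projConst (GordonLewis.SymTensorSymInj (m - 1) X) := by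
  obtain ⟨k, rfl⟩ : ∃ k, m = k + 1 := ⟨m - 1, by omega⟩
  refine ⟨GordonLewis.gl_symTensorInj_le x hx k,
    (GordonLewis.gl_symTensorSymInj_le x hx k).trans ?_⟩
  -- The direct argument loses only one factor `mᵐ / m! ≥ 1`.
  have h1 : (1 : ENNReal) ≤ ((k + 1 : ℕ) : ENNReal) ^ (k + 1) / ((k + 1).factorial : ENNReal) := by
    rw [ENNReal.le_div_iff_mul_le (by simp [Nat.factorial_ne_zero]) (by simp), one_mul]
    exact_mod_cast (k + 1).factorial_le_pow
  rw [Nat.add_sub_cancel]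
  gcongr
  exact le_self_pow h1 two_ne_zero
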